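/- **Setting.** Let $\mathcal L_\Sigma$ be the description logic $\mathcal{SROIQ}$ over atomic concepts $\mathrm{NC}$, atomic roles $\mathrm{NR}$ and individual names $\mathrm{NI}$. We work under the standard name assumption (the domain of every interpretation is a fixed set $\mathrm{NI}_S\subseteq\mathrm{NI}$ of standard names, each of which denotes itself) and the unique name assumption (distinct individual names denote distinct elements). Let $\mathbf N$ be a set of contexts. The contextual language $\mathcal L_{\Sigma,\mathbf N}$ has in addition the concepts (roles) $\mathit{eval}(X,c)$, for a concept (role) $X$ of $\mathcal L_\Sigma$ and $c\in\mathbf N$. A *multi-relational simple CKR (sCKR)* $\mathfrak K$ consists of strict orders $\prec_1,\dots,\prec_m$ on $\mathbf N$ and, for each $c\in\mathbf N$, a knowledge base $K_c$ of strict axioms of $\mathcal L_{\Sigma,\mathbf N}$ and of defeasible axioms $D_i(\alpha)$, $1\le i\le m$, $\alpha$ an axiom of $\mathcal L_\Sigma$. Let $\preceq_{-i}$ (resp. $\preceq_*$) be the reflexive and transitive closure of $\bigcup_{j\ne i}\prec_j$ (resp. $\bigcup_j\prec_j$). For an axiom $\alpha$ with first-order translation $\forall\vec x.\,\varphi_\alpha(\vec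 x)$ and a tuple $\vec e$ of individual names, $\alpha(\vec e)=\varphi_\alpha(\vec e)$ is the instantiation of $\alpha$ with $\vec e$. **CAS models.** An interpretation $\mathfrak I=\{\mathcal I(c)\}_{c\in\mathbf N}$ is a family of DL interpretations with a common domain and common interpretation of the individual names, where $\mathit{eval}(X,c')^{\mathcal I(c)}=X^{\mathcal I(c')}$. A *clashing assumption* for $c$ and $\prec_i$ is a pair $\langle\alpha,\vec e\rangle$ such that $D_i(\alpha)\in K_{c'}$ for some $c'\succeq_{-i}c''\succ_i c$. A *CAS-interpretation* is $\langle\mathfrak I,\chi_1,\dots,\chi_m\rangle$, where $\chi_i(c)$ is a set of clashing assumptions for $c$ and $\prec_i$. It is a *CAS-model* of $\mathfrak K$ if (i) $\mathcal I(c')\models\alpha$ for every strict $\alpha\in K_c$ and $c'\preceq_*c$; (ii) $\mathcal I(c')\models\alpha$ for every $D_i(\alpha)\in K_c$ and $c'\preceq_{-i}c$; (iii) $\mathcal I(c'')\models\alpha(\vec d)$ for every $D_i(\alpha)\in K_c$, $c''\prec_i c'\preceq_{-i}c$ and $\langle\alpha,\vec d\rangle\notin\chi_i(c'')$. A *clashing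 set* for $\langle\alpha,\vec e\rangle$ is a satisfiable set $S$ of ABox assertions of $\mathcal L_\Sigma$ such that $S\cup\{\alpha(\vec e)\}$ is unsatisfiable. A CAS-model $\langle\mathfrak I,\overline\chi\rangle$ is *justified* if every $\langle\alpha,\vec e\rangle\in\chi_i(c)$ has a clashing set $S$ such that $\mathcal I'(c)\models S$ for every CAS-model $\langle\mathfrak I',\overline\chi\rangle$ of $\mathfrak K$ (with the same $\overline\chi$) in which all individual names are interpreted as in $\mathfrak I$. **Preference.** For sets $X,Y$ of clashing assumptions for $c$ and $\prec_i$, write $X>Y$ (and $Y<X$) if for every $\langle\alpha_1,\vec e\rangle\in X\setminus Y$ and all $c_1\succeq_{-i}c_{1b}\succ_i c$ with $D_i(\alpha_1)\in K_{c_1}$ there are $\langle\alpha_2,\vec f\rangle\in Y\setminus X$ and $c_2\succeq_{-i}c_{2b}\succ_i c$ with $D_i(\alpha_2)\in K_{c_2}$ and $c_{1b}\succ_i c_{2b}$. For CAS-interpretations $\mathfrak J^k=\langle\mathfrak I^k,\chi^k_1,\dots,\chi^k_m\rangle$, $k=1,2$: * $P_{1,i}(\mathfrak J^1,\mathfrak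 J^2)$ holds iff there is $c\in\mathbf N$ with $\chi^1_i(c)>\chi^2_i(c)$ and not $\chi^2_i(c)>\chi^1_i(c)$, and for no $c'\ne c$ in $\mathbf N$ it holds that $\chi^1_i(c')<\chi^2_i(c')$ and not $\chi^2_i(c')<\chi^1_i(c')$; * $P_{2,i}(\mathfrak J^1,\mathfrak J^2)$ holds iff there is $c\in\mathbf N$ with $\chi^1_i(c)>\chi^2_i(c)$ and not $\chi^2_i(c)>\chi^1_i(c)$, and for all $c'\in\mathbf N$ it holds that $\chi^1_i(c')>\chi^2_i(c')$ or $\chi^1_i(c')=\chi^2_i(c')$. $\mathfrak J$ is *preferred* with respect to a relation $P$ if there is no justified CAS-model $\mathfrak J'$ of $\mathfrak K$ with $P(\mathfrak J',\mathfrak J)$. **Eval-disconnectedness.** The dependency graph of $\mathfrak K$ has a vertex $X_c$ for every concept or role $X$ that occurs in $\mathfrak K$ and every $c\in\mathbf N$; there is an edge from $X_c$ to $X'_{c'}$ if (i) $c=c'$ and $X'$ is a subexpression of $X$, or (ii) $c=c'$ and $X,X'$ co-occur in some (strict or defeasible) axiom of $\mathfrak K$, or (iii) $X=\mathit{eval}(X',c')$.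 In (i) and (ii) an expression $\mathit{eval}(X',c')$ counts as atomic. $\mathfrak K$ is *eval-disconnected* if for all concepts or roles $X,X'$ that occur in defeasible axioms and all $c\ne c'$ the vertices $X_c$ and $X'_{c'}$ are not connected by a path, where edges may be used in both directions. **Theorem.** Let $\mathfrak K$ be an eval-disconnected sCKR, $\mathfrak J$ a justified CAS-model of $\mathfrak K$, and $1\le i\le m$. Then $\mathfrak J$ is preferred with respect to $P_{1,i}$ if and only if it is preferred with respect to $P_{2,i}$. -/

import Mathlib

/-! Contextualized knowledge repositories over the description logic SROIQ. -/

namespace CKR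

/-! ### Description logic: language -/

/-- Roles over the atomic roles `NR`: atomic roles, inverse roles, the universal role. -/
inductive Role (NR : Type*) where
  | atom (R : NR)
  | inv (R : Role NR)
  | univ

/-- SROIQ concepts over atomic concepts `NC`, atomic roles `NR` and individual names `NI`. -/
inductive Concept (NC NR NI : Type*) where
  | atom (A : NC)
  | top
  | bot
  | nominal (a : NI)
  | neg (C : Concept NC NR NI)
  | inf (C D : Concept NC NR NI)
  | sup (C D : Concept NC NR NI)
  | ex (R : Role NR) (C : Concept NC NR NI)
  | all (R : Role NR) (C : Concept NC NR NI)
  | self (R : Role NR)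
  | atLeast (n : ℕ) (R : Role NR) (C : Concept NC NR NI)
  | atMost (n : ℕ) (R : Role NR) (C : Concept NC NR NI)

/-- ABox assertions `C(a)`, `R(a,b)`, `¬R(a,b)`, `a = b`, `a ≠ b`. -/
inductive Assertion (NC NR NI : Type*) where
  | concept (C : Concept NC NR NI) (a : NI)
  | role (R : Role NR) (a b : NI)
  | negRole (R : Role NR) (a b : NI)
  | eq (a b : NI)
  | ne (a b : NI)

/-- SROIQ axioms (TBox, RBox and ABox). `roleIncl R w S` is the role inclusion
`R ∘ w₁ ∘ ⋯ ∘ wₙ ⊑ S` (a plain inclusion `R ⊑ S` if `w = []`). -/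
inductive Ax (NC NR NI : Type*) where
  | conceptIncl (C D : Concept NC NR NI)
  | conceptEquiv (C D : Concept NC NR NI)
  | roleIncl (R : Role NR) (w : List (Role NR)) (S : Role NR)
  | disjoint (R S : Role NR)
  | inverse (R S : Role NR)
  | refl (R : Role NR)
  | irrefl (R : Role NR)
  | symm (R : Role NR)
  | asymm (R : Role NR)
  | trans (R : Role NR)
  | assertion (s : Assertion NC NR NI)

/-! ### Description logic: semantics -/

/-- A DL interpretation under the standard name assumption and the unique name assumption.
`NIS ⊆ NI` is the set of standard names, uniform for all interpretations: the domain consists of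
the standard names, and each of them denotes itself. Distinct individual names denote distinct
elements. -/
structure Interp (NC NR : Type*) {NI : Type*} (NIS : Set NI) where
  ind : NI → NIS
  ind_standard : ∀ s : NIS, ind s = s
  ind_injective : Function.Injective ind
  con : NC → Set NIS
  rol : NR → NIS → NIS → Prop

section Semantics

variable {NC NR NI : Type*} {NIS : Set NI}

/-- The interpretation `R^I` of a role. -/
def Role.interp (I : Interp NC NR NIS) : Role NR → NIS → NIS → Prop
  | .atom R => I.rol R
  | .inv R => fun x y => R.interp I y x
  | .univ => fun _ _ => True

/-- The interpretation `C^I` of a concept. -/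
def Concept.interp (I : Interp NC NR NIS) : Concept NC NR NI → Set NIS
  | .atom A => I.con A
  | .top => Set.univ
  | .bot => ∅
  | .nominal a => {I.ind a}
  | .neg C => (C.interp I)ᶜ
  | .inf C D => C.interp I ∩ D.interp I
  | .sup C D => C.interp I ∪ D.interp I
  | .ex R C => {x | ∃ y, R.interp I x y ∧ y ∈ C.interp I}
  | .all R C => {x | ∀ y, R.interp I x y → y ∈ C.interp I}
  | .self R => {x | R.interp I x x}
  | .atLeast n R C => {x | (n : ℕ∞) ≤ Set.encard {y | R.interp I x y ∧ y ∈ C.interp I}}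
  | .atMost n R C => {x | Set.encard {y | R.interp I x y ∧ y ∈ C.interp I} ≤ (n : ℕ∞)}

/-- The composition of a list of roles. -/
def chainInterp (I : Interp NC NR NIS) : List (Role NR) → NIS → NIS → Prop
  | [] => fun x y => x = y
  | R :: w => fun x y => ∃ z, R.interp I x z ∧ chainInterp I w z y

/-- `I ⊨ s` for an ABox assertion `s`. -/
def Assertion.Sat (I : Interp NC NR NIS) : Assertion NC NR NI → Prop
  | .concept C a => I.ind a ∈ C.interp I
  | .role R a b => R.interp I (I.ind a) (I.ind b)
  | .negRole R a b => ¬ R.interp I (I.ind a) (I.ind b)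
  | .eq a b => I.ind a = I.ind b
  | .ne a b => I.ind a ≠ I.ind b

/-- `I ⊨ α` for an axiom `α`. -/
def Ax.Sat (I : Interp NC NR NIS) : Ax NC NR NI → Prop
  | .conceptIncl C D => C.interp I ⊆ D.interp I
  | .conceptEquiv C D => C.interp I = D.interp I
  | .roleIncl R w S => ∀ x y, chainInterp I (R :: w) x y → S.interp I x y
  | .disjoint R S => ∀ x y, ¬ (R.interp I x y ∧ S.interp I x y)
  | .inverse R S => ∀ x y, R.interp I x y ↔ S.interp I y x
  | .refl R => ∀ x, R.interp I x x
  | .irrefl R => ∀ x, ¬ R.interp I x x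
  | .symm R => ∀ x y, R.interp I x y → R.interp I y x
  | .asymm R => ∀ x y, R.interp I x y → ¬ R.interp I y x
  | .trans R => ∀ x y z, R.interp I x y → R.interp I y z → R.interp I x z
  | .assertion s => s.Sat I

/-! ### Axiom instantiation

An axiom `α` has a first-order translation `∀ x₁ … xₖ, φ_α(x₁, …, xₖ)`; its instantiation with a
tuple `e` of individual names is `φ_α(e)`. For `C ⊑ D` the prefix consists of the variable for the
elements of `C` and of the universal quantifiers with which the translation of `D` starts:
`A ⊑ ∀R.B` is `∀ x y, A(x) ∧ R(x,y) → B(y)`, and `A ⊑ ≤ 1 R.⊤` is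
`∀ x y₀ y₁, A(x) ∧ R(x,y₀) ∧ R(x,y₁) → y₀ = y₁`. -/

/-- The number of universal quantifiers with which the translation of a concept starts. -/
def Concept.arity : Concept NC NR NI → ℕ
  | .all _ C => C.arity + 1
  | .atMost n _ _ => n + 1
  | _ => 0

/-- The length `k` of the tuples with which an axiom is instantiated. -/
def Ax.arity : Ax NC NR NI → ℕ
  | .conceptIncl _ D => D.arity + 1
  | .conceptEquiv _ _ => 1
  | .roleIncl _ w _ => w.length + 2
  | .disjoint _ _ => 2
  | .inverse _ _ => 2
  | .refl _ => 1
  | .irrefl _ => 1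
  | .symm _ => 2
  | .asymm _ => 2
  | .trans _ => 3
  | .assertion _ => 0

/-- The matrix of the translation of `D` at the individual `a`, with the leading universal
quantifiers instantiated by the tuple (of length `D.arity`). -/
def Concept.Inst (I : Interp NC NR NIS) : Concept NC NR NI → NI → List NI → Prop
  | .all R C, a, b :: e => R.interp I (I.ind a) (I.ind b) → C.Inst I b e
  | .atMost _ R C, a, e =>
      (∀ b ∈ e, R.interp I (I.ind a) (I.ind b) ∧ I.ind b ∈ C.interp I) →
        ¬ (e.map I.ind).Nodup
  | C, a, _ => I.ind a ∈ C.interp I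

/-- `R₁(y,z₁) ∧ R₂(z₁,z₂) ∧ ⋯ ∧ Rₙ(zₙ₋₁,zₙ) → S(x,zₙ)`. -/
def chainInst (I : Interp NC NR NIS) (S : Role NR) (x : NI) :
    List (Role NR) → NI → List NI → Prop
  | R :: w, y, z :: e => R.interp I (I.ind y) (I.ind z) → chainInst I S x w z e
  | _, y, _ => S.interp I (I.ind x) (I.ind y)

/-- `I ⊨ φ_α(e)`; only tuples `e` of length `α.arity` are instantiations. -/
def Ax.Inst (I : Interp NC NR NIS) : Ax NC NR NI → List NI → Prop
  | .conceptIncl C D, a :: e => I.ind a ∈ C.interp I → D.Inst I a e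
  | .conceptEquiv C D, [a] => (I.ind a ∈ C.interp I ↔ I.ind a ∈ D.interp I)
  | .roleIncl R w S, a :: e => chainInst I S a (R :: w) a e
  | .disjoint R S, [a, b] =>
      ¬ (R.interp I (I.ind a) (I.ind b) ∧ S.interp I (I.ind a) (I.ind b))
  | .inverse R S, [a, b] =>
      (R.interp I (I.ind a) (I.ind b) ↔ S.interp I (I.ind b) (I.ind a))
  | .refl R, [a] => R.interp I (I.ind a) (I.ind a)
  | .irrefl R, [a] => ¬ R.interp I (I.ind a) (I.ind a)
  | .symm R, [a, b] => R.interp I (I.ind a) (I.ind b) → R.interp I (I.ind b) (I.ind a)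
  | .asymm R, [a, b] => R.interp I (I.ind a) (I.ind b) → ¬ R.interp I (I.ind b) (I.ind a)
  | .trans R, [a, b, c] =>
      R.interp I (I.ind a) (I.ind b) → R.interp I (I.ind b) (I.ind c) →
        R.interp I (I.ind a) (I.ind c)
  | .assertion s, [] => s.Sat I
  | _, _ => False

/-- `S` is a clashing set for `⟨α, e⟩`: a satisfiable set of ABox assertions such that
`S ∪ {α(e)}` is unsatisfiable. -/
def IsClashingSet (NIS : Set NI) (x : Ax NC NR NI × List NI) (S : Set (Assertion NC NR NI)) :
    Prop :=
  (∃ I : Interp NC NR NIS, ∀ s ∈ S, s.Sat I) ∧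
    ¬ ∃ I : Interp NC NR NIS, (∀ s ∈ S, s.Sat I) ∧ x.1.Inst I x.2

end Semantics

/-! ### The contextual language -/

/-- Atomic concepts of the contextual language: those of the DL, and `eval(C, c)` for a concept `C`
of the DL and a context `c`. -/
inductive EConc (NC NR NI N : Type*) where
  | base (A : NC)
  | eval (C : Concept NC NR NI) (c : N)

/-- Atomic roles of the contextual language: those of the DL, and `eval(R, c)` for a role `R` of
the DL and a context `c`. -/
inductive ERole (NR N : Type*) where
  | base (R : NR)
  | eval (R : Role NR) (c : N)

/-- A multi-relational simple CKR with contexts `N` and contextual relations `≺₁, …, ≺ₘ`;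
`prec i c₁ c₂` is `c₁ ≺ᵢ c₂`. The knowledge base of the context `c` consists of the strict axioms
`strict c` of the contextual language and of the defeasible axioms `D_i(α)` with
`(i, α) ∈ defeasible c`, where `α` is an axiom of the DL. -/
structure SCKR (NC NR NI N : Type*) (m : ℕ) where
  prec : Fin m → N → N → Prop
  prec_strict : ∀ i, IsStrictOrder N (prec i)
  strict : N → Set (Ax (EConc NC NR NI N) (ERole NR N) NI)
  defeasible : N → Set (Fin m × Ax NC NR NI)

/-- An interpretation of the contextual language: a DL interpretation for every context, with a
common domain (here by the standard name assumption) and a common interpretation of the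
individual names. -/
structure CInterp (NC NR : Type*) {NI : Type*} (NIS : Set NI) (N : Type*) where
  loc : N → Interp NC NR NIS
  ind_eq : ∀ c c', (loc c).ind = (loc c').ind

section CKR

variable {NC NR NI N : Type*} {m : ℕ} {NIS : Set NI}

/-- The local interpretation at `c`, extended to `eval` expressions by
`eval(X, c')^{I(c)} = X^{I(c')}`. -/
def CInterp.ext (I : CInterp NC NR NIS N) (c : N) :
    Interp (EConc NC NR NI N) (ERole NR N) NIS where
  ind := (I.loc c).ind
  ind_standard := (I.loc c).ind_standard
  ind_injective := (I.loc c).ind_injective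
  con
    | .base A => (I.loc c).con A
    | .eval C c' => C.interp (I.loc c')
  rol
    | .base R => (I.loc c).rol R
    | .eval R c' => R.interp (I.loc c')

/-- `c₁ ⪯₋ᵢ c₂`: the reflexive and transitive closure of the union of the `≺ⱼ` with `j ≠ i`. -/
def SCKR.leExcept (K : SCKR NC NR NI N m) (i : Fin m) : N → N → Prop :=
  Relation.ReflTransGen fun a b => ∃ j, j ≠ i ∧ K.prec j a b

/-- `c₁ ⪯_* c₂`: the reflexive and transitive closure of the union of all the `≺ⱼ`. -/
def SCKR.leAll (K : SCKR NC NR NI N m) : N → N → Prop :=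
  Relation.ReflTransGen fun a b => ∃ j, K.prec j a b

/-- `D_i(α)` is in the knowledge base of some `c₁` with `c₁ ⪰₋ᵢ b ≻ᵢ c`. -/
def SCKR.DefaultVia (K : SCKR NC NR NI N m) (i : Fin m) (c b : N) (α : Ax NC NR NI) : Prop :=
  ∃ c₁, (i, α) ∈ K.defeasible c₁ ∧ K.leExcept i b c₁ ∧ K.prec i c b

/-- `⟨α, e⟩` is a clashing assumption for the context `c` and the contextual relation `≺ᵢ`. -/
def SCKR.IsClashingAssumption (K : SCKR NC NR NI N m) (i : Fin m) (c : N)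
    (x : Ax NC NR NI × List NI) : Prop :=
  x.2.length = x.1.arity ∧ ∃ b, K.DefaultVia i c b x.1

/-- A CAS-interpretation `⟨I, χ₁, …, χₘ⟩`. -/
structure CASInterp (K : SCKR NC NR NI N m) (NIS : Set NI) where
  interp : CInterp NC NR NIS N
  chi : Fin m → N → Set (Ax NC NR NI × List NI)
  chi_clashing : ∀ i c, ∀ x ∈ chi i c, K.IsClashingAssumption i c x

/-- CAS-models of `K`. -/
structure CASInterp.IsModel {K : SCKR NC NR NI N m} (J : CASInterp K NIS) : Prop where
  strict : ∀ c, ∀ α ∈ K.strict c, ∀ c', K.leAll c' c → α.Sat (J.interp.ext c')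
  parallel : ∀ c i α, (i, α) ∈ K.defeasible c → ∀ c', K.leExcept i c' c →
    α.Sat (J.interp.loc c')
  defeasible : ∀ c i α, (i, α) ∈ K.defeasible c → ∀ c' c'', K.prec i c'' c' →
    K.leExcept i c' c → ∀ d : List NI, d.length = α.arity → (α, d) ∉ J.chi i c'' →
      α.Inst (J.interp.loc c'') d

/-- `NI`-congruence: all the individual names are interpreted in the same way. -/
def CASInterp.Congruent {K : SCKR NC NR NI N m} (J J' : CASInterp K NIS) : Prop :=
  ∀ c, (J.interp.loc c).ind = (J'.interp.loc c).ind

/-- Justified CAS-models of `K`. -/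
def CASInterp.IsJustified {K : SCKR NC NR NI N m} (J : CASInterp K NIS) : Prop :=
  J.IsModel ∧ ∀ i c, ∀ x ∈ J.chi i c, ∃ S : Set (Assertion NC NR NI),
    IsClashingSet NIS x S ∧
      ∀ J' : CASInterp K NIS, J'.IsModel → J'.chi = J.chi → J'.Congruent J →
        ∀ s ∈ S, s.Sat (J'.interp.loc c)

/-! ### Preference -/

/-- The local preference `X > Y` between sets of clashing assumptions for the context `c` and the
relation `≺ᵢ`. -/
def SCKR.LocPref (K : SCKR NC NR NI N m) (i : Fin m) (c : N)
    (X Y : Set (Ax NC NR NI × List NI)) : Prop :=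
  ∀ x ∈ X \ Y, ∀ b₁, K.DefaultVia i c b₁ x.1 →
    ∃ y ∈ Y \ X, ∃ b₂, K.DefaultVia i c b₂ y.1 ∧ K.prec i b₂ b₁

/-- The relation `P_{1,i}`. -/
def P₁ {K : SCKR NC NR NI N m} (i : Fin m) (J₁ J₂ : CASInterp K NIS) : Prop :=
  ∃ c, (K.LocPref i c (J₁.chi i c) (J₂.chi i c) ∧ ¬ K.LocPref i c (J₂.chi i c) (J₁.chi i c)) ∧
    ¬ ∃ c', c' ≠ c ∧ K.LocPref i c' (J₂.chi i c') (J₁.chi i c') ∧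
      ¬ K.LocPref i c' (J₁.chi i c') (J₂.chi i c')

/-- The relation `P_{2,i}`. -/
def P₂ {K : SCKR NC NR NI N m} (i : Fin m) (J₁ J₂ : CASInterp K NIS) : Prop :=
  (∃ c, K.LocPref i c (J₁.chi i c) (J₂.chi i c) ∧ ¬ K.LocPref i c (J₂.chi i c) (J₁.chi i c)) ∧
    ∀ c', K.LocPref i c' (J₁.chi i c') (J₂.chi i c') ∨ J₁.chi i c' = J₂.chi i c'

/-- `J` is preferred with respect to `P`: no justified CAS-model is `P`-better than `J`. -/
def IsPreferred {K : SCKR NC NR NI N m} (P : CASInterp K NIS → CASInterp K NIS → Prop)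
    (J : CASInterp K NIS) : Prop :=
  ¬ ∃ J' : CASInterp K NIS, J'.IsJustified ∧ P J' J

end CKR

/-! ### The dependency graph -/

/-- Concepts and roles, as the expressions that label the vertices of the dependency graph. -/
inductive Expr (NC NR NI : Type*) where
  | concept (C : Concept NC NR NI)
  | role (R : Role NR)

section Dependency

variable {NC NR NI NC₂ NR₂ N : Type*} {m : ℕ}

/-- Renaming of the atomic roles of a role. -/
def Role.map (g : NR → NR₂) : Role NR → Role NR₂
  | .atom R => .atom (g R)
  | .inv R => .inv (R.map g)
  | .univ => .univ

/-- Renaming of the atomic concepts and roles of a concept. -/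
def Concept.map (f : NC → NC₂) (g : NR → NR₂) : Concept NC NR NI → Concept NC₂ NR₂ NI
  | .atom A => .atom (f A)
  | .top => .top
  | .bot => .bot
  | .nominal a => .nominal a
  | .neg C => .neg (C.map f g)
  | .inf C D => .inf (C.map f g) (D.map f g)
  | .sup C D => .sup (C.map f g) (D.map f g)
  | .ex R C => .ex (R.map g) (C.map f g)
  | .all R C => .all (R.map g) (C.map f g)
  | .self R => .self (R.map g)
  | .atLeast n R C => .atLeast n (R.map g) (C.map f g)
  | .atMost n R C => .atMost n (R.map g) (C.map f g)

/-- Renaming of the atomic concepts and roles of an assertion. -/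
def Assertion.map (f : NC → NC₂) (g : NR → NR₂) : Assertion NC NR NI → Assertion NC₂ NR₂ NI
  | .concept C a => .concept (C.map f g) a
  | .role R a b => .role (R.map g) a b
  | .negRole R a b => .negRole (R.map g) a b
  | .eq a b => .eq a b
  | .ne a b => .ne a b

/-- Renaming of the atomic concepts and roles of an axiom. -/
def Ax.map (f : NC → NC₂) (g : NR → NR₂) : Ax NC NR NI → Ax NC₂ NR₂ NI
  | .conceptIncl C D => .conceptIncl (C.map f g) (D.map f g)
  | .conceptEquiv C D => .conceptEquiv (C.map f g) (D.map f g)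
  | .roleIncl R w S => .roleIncl (R.map g) (w.map (Role.map g)) (S.map g)
  | .disjoint R S => .disjoint (R.map g) (S.map g)
  | .inverse R S => .inverse (R.map g) (S.map g)
  | .refl R => .refl (R.map g)
  | .irrefl R => .irrefl (R.map g)
  | .symm R => .symm (R.map g)
  | .asymm R => .asymm (R.map g)
  | .trans R => .trans (R.map g)
  | .assertion s => .assertion (s.map f g)

/-- The inclusion of the roles of the DL in the contextual language. -/
def Role.lift (N : Type*) (R : Role NR) : Role (ERole NR N) := R.map .base

/-- The inclusion of the concepts of the DL in the contextual language. -/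
def Concept.lift (N : Type*) (C : Concept NC NR NI) :
    Concept (EConc NC NR NI N) (ERole NR N) NI := C.map .base .base

/-- The inclusion of the axioms of the DL in the contextual language. -/
def Ax.lift (N : Type*) (α : Ax NC NR NI) : Ax (EConc NC NR NI N) (ERole NR N) NI :=
  α.map .base .base

/-- The subexpressions of a role, including the role itself. -/
def Role.subs (NC NI : Type*) : Role NR → Set (Expr NC NR NI)
  | .atom R => {.role (.atom R)}
  | .inv R => insert (.role (.inv R)) (R.subs NC NI)
  | .univ => {.role .univ}

/-- The subexpressions (concepts and roles) of a concept, including the concept itself. -/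
def Concept.subs : Concept NC NR NI → Set (Expr NC NR NI)
  | .atom A => {.concept (.atom A)}
  | .top => {.concept .top}
  | .bot => {.concept .bot}
  | .nominal a => {.concept (.nominal a)}
  | .neg C => insert (.concept (.neg C)) C.subs
  | .inf C D => insert (.concept (.inf C D)) (C.subs ∪ D.subs)
  | .sup C D => insert (.concept (.sup C D)) (C.subs ∪ D.subs)
  | .ex R C => insert (.concept (.ex R C)) (R.subs NC NI ∪ C.subs)
  | .all R C => insert (.concept (.all R C)) (R.subs NC NI ∪ C.subs)
  | .self R => insert (.concept (.self R)) (R.subs NC NI)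
  | .atLeast n R C => insert (.concept (.atLeast n R C)) (R.subs NC NI ∪ C.subs)
  | .atMost n R C => insert (.concept (.atMost n R C)) (R.subs NC NI ∪ C.subs)

/-- The subexpressions of an expression, including the expression itself. -/
def Expr.subs : Expr NC NR NI → Set (Expr NC NR NI)
  | .concept C => C.subs
  | .role R => R.subs NC NI

/-- The concepts and roles that occur in an assertion. -/
def Assertion.exprs : Assertion NC NR NI → Set (Expr NC NR NI)
  | .concept C _ => C.subs
  | .role R _ _ => R.subs NC NI
  | .negRole R _ _ => R.subs NC NI
  | .eq _ _ => ∅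
  | .ne _ _ => ∅

/-- The concepts and roles that occur in an axiom. -/
def Ax.exprs : Ax NC NR NI → Set (Expr NC NR NI)
  | .conceptIncl C D => C.subs ∪ D.subs
  | .conceptEquiv C D => C.subs ∪ D.subs
  | .roleIncl R w S => R.subs NC NI ∪ {X | ∃ Q ∈ w, X ∈ Q.subs NC NI} ∪ S.subs NC NI
  | .disjoint R S => R.subs NC NI ∪ S.subs NC NI
  | .inverse R S => R.subs NC NI ∪ S.subs NC NI
  | .refl R => R.subs NC NI
  | .irrefl R => R.subs NC NI
  | .symm R => R.subs NC NI
  | .asymm R => R.subs NC NI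
  | .trans R => R.subs NC NI
  | .assertion s => s.exprs

/-- The concepts and roles of the contextual language. -/
abbrev CExpr (NC NR NI N : Type*) := Expr (EConc NC NR NI N) (ERole NR N) NI

/-- The (strict or defeasible) axioms of `K`, without the marks `D_i`. -/
def SCKR.axioms (K : SCKR NC NR NI N m) : Set (Ax (EConc NC NR NI N) (ERole NR N) NI) :=
  {α | ∃ c, α ∈ K.strict c ∨ ∃ i β, (i, β) ∈ K.defeasible c ∧ α = β.lift N}

/-- The concepts and roles that occur in `K`, including those that occur inside of an `eval`
expression. -/
inductive SCKR.Occurs (K : SCKR NC NR NI N m) : CExpr NC NR NI N → Prop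
  | ofAx {α X} : α ∈ K.axioms → X ∈ α.exprs → K.Occurs X
  | ofEvalConcept {C c X} : K.Occurs (.concept (.atom (.eval C c))) → X ∈ (C.lift N).subs →
      K.Occurs X
  | ofEvalRole {R c X} : K.Occurs (.role (.atom (.eval R c))) → X ∈ (R.lift N).subs _ NI →
      K.Occurs X

/-- The concepts and roles that occur in default axioms of `K`. -/
def SCKR.OccursInDefault (K : SCKR NC NR NI N m) (X : CExpr NC NR NI N) : Prop :=
  ∃ c i α, (i, α) ∈ K.defeasible c ∧ X ∈ (α.lift N).exprs

/-- The edges of the dependency graph `DEP(K)`. The vertices are the pairs `(X, c)`, for `X_c`,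
of a concept or role `X` that occurs in `K` and a context `c`. -/
inductive SCKR.DepEdge (K : SCKR NC NR NI N m) : CExpr NC NR NI N × N → CExpr NC NR NI N × N → Prop
  | sub {X Y} (c : N) : K.Occurs X → Y ∈ X.subs → K.DepEdge (X, c) (Y, c)
  | cooccur {α X Y} (c : N) : α ∈ K.axioms → X ∈ α.exprs → Y ∈ α.exprs → K.DepEdge (X, c) (Y, c)
  | evalConcept {C} (c c' : N) : K.Occurs (.concept (.atom (.eval C c'))) →
      K.DepEdge (.concept (.atom (.eval C c')), c) (.concept (C.lift N), c')
  | evalRole {R} (c c' : N) : K.Occurs (.role (.atom (.eval R c'))) →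
      K.DepEdge (.role (.atom (.eval R c')), c) (.role (R.lift N), c')

/-- `K` is `eval`-disconnected: for concepts or roles `X`, `Y` that occur in default axioms and
contexts `c ≠ c'` there is no path between `X_c` and `Y_c'` in `DEP(K)`, where a path may use the
edges in both directions (`X_c` and `Y_c'` lie in different components). -/
def SCKR.EvalDisconnected (K : SCKR NC NR NI N m) : Prop :=
  ∀ X Y, K.OccursInDefault X → K.OccursInDefault Y → ∀ c c', c ≠ c' →
    ¬ Relation.EqvGen K.DepEdge (X, c) (Y, c')

end Dependency

end CKR

/-! A better model for `P₂` is one for `P₁`, because local preference is reflexive. The converse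
rests on locality. Suppose a justified model `J₁` improves on `J₂` at `c`. Transplant into `J₂`
everything that `J₁` says about the defaults at `c`: its clashing assumptions for `c`, and its
interpretation on all components of the dependency graph that meet a default vertex at `c`. The
result differs from `J₂` in clashing assumptions only at `c`, where it is strictly better, so it is
`P₂`-better than `J₂`. What remains is that `CASInterp.merge` preserves justified models.

It preserves models (`CASInterp.IsModel.merge`) because each axiom at each context sees one side
only: co-occurring expressions lie in one component, and disconnectedness keeps default vertices at
other contexts out of the transplanted part.

For justification, `CASInterp.isJustified_iff` eliminates clashing sets. Individual names are rigid,
and the failure of an instance is itself a set of assertions (`Ax.expressible_not_inst`), so being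
justified means that every assumed instance fails in all models with the same assumptions. A second
transplant shows that this depends only on the assumptions for the context in question
(`CASInterp.IsJustified.not_inst_of_chi_eq`). -/

namespace CKR

/-! ### Individual names -/

section Names

variable {NC NR NC₂ NR₂ NI : Type*} {NIS : Set NI}

/-- Under the standard and unique name assumptions every individual name denotes itself. -/
theorem Interp.coe_ind (I : Interp NC NR NIS) (a : NI) : (I.ind a : NI) = a :=
  I.ind_injective (I.ind_standard (I.ind a))

/-- Names are rigid, so coincidence lemmas need to compare only atomic concepts and roles, and a
merged interpretation may take its names from either side. -/
theorem Interp.ind_unique (I : Interp NC NR NIS) (I' : Interp NC₂ NR₂ NIS) : I.ind = I'.ind := by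
  funext a
  exact Subtype.ext ((I.coe_ind a).trans (I'.coe_ind a).symm)

end Names

/-! ### Coincidence lemmas -/

section Coincidence

variable {NC NR NI : Type*} {NIS : Set NI}

/-- The interpretations `I` and `I'` coincide on the atomic concepts and roles in `E`. -/
def AgreeOn (I I' : Interp NC NR NIS) (E : Set (Expr NC NR NI)) : Prop :=
  (∀ A, .concept (.atom A) ∈ E → I.con A = I'.con A) ∧
    ∀ R, .role (.atom R) ∈ E → I.rol R = I'.rol R

theorem AgreeOn.mono {I I' : Interp NC NR NIS} {E F : Set (Expr NC NR NI)} (h : AgreeOn I I' F)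
    (hEF : E ⊆ F) : AgreeOn I I' E :=
  ⟨fun A hA => h.1 A (hEF hA), fun R hR => h.2 R (hEF hR)⟩

theorem agreeOn_union {I I' : Interp NC NR NIS} {E F : Set (Expr NC NR NI)} :
    AgreeOn I I' (E ∪ F) ↔ AgreeOn I I' E ∧ AgreeOn I I' F :=
  ⟨fun h => ⟨h.mono Set.subset_union_left, h.mono Set.subset_union_right⟩, fun h =>
    ⟨fun A hA => hA.elim (h.1.1 A) (h.2.1 A), fun R hR => hR.elim (h.1.2 R) (h.2.2 R)⟩⟩

theorem Role.interp_congr {I I' : Interp NC NR NIS} (R : Role NR)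
    (h : AgreeOn I I' (R.subs NC NI)) : R.interp I = R.interp I' := by
  induction R with
  | atom R => exact h.2 R rfl
  | inv R ih =>
    simp only [Role.interp, ih (h.mono (Set.subset_insert _ _))]
  | univ => rfl

theorem Concept.interp_congr {I I' : Interp NC NR NIS} (C : Concept NC NR NI)
    (h : AgreeOn I I' C.subs) : C.interp I = C.interp I' := by
  induction C with
  | atom A => exact h.1 A rfl
  | top => rfl
  | bot => rfl
  | nominal a => simp only [Concept.interp, I.ind_unique I']
  | neg C ih => simp only [Concept.interp, ih (h.mono (Set.subset_insert _ _))]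
  | inf C D ihC ihD | sup C D ihC ihD =>
    obtain ⟨hC, hD⟩ := agreeOn_union.1 (h.mono (Set.subset_insert _ _))
    simp only [Concept.interp, ihC hC, ihD hD]
  | ex R C ih | all R C ih | atLeast n R C ih | atMost n R C ih =>
    obtain ⟨hR, hC⟩ := agreeOn_union.1 (h.mono (Set.subset_insert _ _))
    simp only [Concept.interp, R.interp_congr hR, ih hC]
  | self R => simp only [Concept.interp, R.interp_congr (h.mono (Set.subset_insert _ _))]

theorem Assertion.sat_congr {I I' : Interp NC NR NIS} (s : Assertion NC NR NI)
    (h : AgreeOn I I' s.exprs) : s.Sat I ↔ s.Sat I' := by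
  cases s with
  | concept C a => simp only [Assertion.Sat, C.interp_congr h, I.ind_unique I']
  | role R a b | negRole R a b => simp only [Assertion.Sat, R.interp_congr h, I.ind_unique I']
  | eq a b | ne a b => simp only [Assertion.Sat, I.ind_unique I']

theorem chainInterp_congr {I I' : Interp NC NR NIS} (w : List (Role NR))
    (h : AgreeOn I I' {X | ∃ Q ∈ w, X ∈ Q.subs NC NI}) : chainInterp I w = chainInterp I' w := by
  induction w with
  | nil => rfl
  | cons R w ih =>
    have hR : R.interp I = R.interp I' :=
      R.interp_congr (h.mono fun X hX => ⟨R, List.mem_cons_self, hX⟩)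
    have hw := ih (h.mono fun X ⟨Q, hQ, hX⟩ => ⟨Q, List.mem_cons_of_mem _ hQ, hX⟩)
    simp only [chainInterp, hR, hw]

theorem Ax.sat_congr {I I' : Interp NC NR NIS} (α : Ax NC NR NI) (h : AgreeOn I I' α.exprs) :
    α.Sat I ↔ α.Sat I' := by
  cases α with
  | conceptIncl C D | conceptEquiv C D =>
    obtain ⟨hC, hD⟩ := agreeOn_union.1 h
    simp only [Ax.Sat, C.interp_congr hC, D.interp_congr hD]
  | roleIncl R w S =>
    obtain ⟨hRw, hS⟩ := agreeOn_union.1 h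
    obtain ⟨hR, hw⟩ := agreeOn_union.1 hRw
    simp only [Ax.Sat, chainInterp, R.interp_congr hR, S.interp_congr hS, chainInterp_congr w hw]
  | disjoint R S | inverse R S =>
    obtain ⟨hR, hS⟩ := agreeOn_union.1 h
    simp only [Ax.Sat, R.interp_congr hR, S.interp_congr hS]
  | refl R | irrefl R | symm R | asymm R | trans R => simp only [Ax.Sat, R.interp_congr h]
  | assertion s => exact s.sat_congr h

end Coincidence

/-! ### The failure of an instance as a set of assertions -/

section NegInst

variable {NC NR NI : Type*} {NIS : Set NI}

/-- The concept `∃R.{b}`, whose elements are the `R`-predecessors of `b`. -/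
theorem Role.mem_ex_nominal (I : Interp NC NR NIS) (R : Role NR) (x : NIS) (b : NI) :
    x ∈ (Concept.ex R (.nominal b) : Concept NC NR NI).interp I ↔ R.interp I x (I.ind b) := by
  simp [Concept.interp]

/-- A set of assertions defines the property `P` of interpretations. -/
def Expressible (P : Interp NC NR NIS → Prop) : Prop :=
  ∃ S : Set (Assertion NC NR NI), ∀ I, (∀ s ∈ S, s.Sat I) ↔ P I

theorem Expressible.of_assertion (s : Assertion NC NR NI) {P : Interp NC NR NIS → Prop}
    (h : ∀ I, s.Sat I ↔ P I) : Expressible P :=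
  ⟨{s}, fun I => by simp [h I]⟩

theorem expressible_true : Expressible (fun _ : Interp NC NR NIS => True) :=
  ⟨∅, by simp⟩

theorem Expressible.and {P Q : Interp NC NR NIS → Prop} (hP : Expressible P)
    (hQ : Expressible Q) : Expressible fun I => P I ∧ Q I := by
  obtain ⟨S, hS⟩ := hP
  obtain ⟨T, hT⟩ := hQ
  exact ⟨S ∪ T, fun I => by
    simp only [Set.mem_union, or_imp, forall_and, hS, hT]⟩

/-- Clashing sets need not be finite, so arbitrary conjunctions are allowed; `Sort*` lets the index
be a membership proof. -/
theorem Expressible.forall {ι : Sort*} {P : ι → Interp NC NR NIS → Prop}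
    (h : ∀ k, Expressible (P k)) : Expressible fun I => ∀ k, P k I := by
  choose S hS using h
  refine ⟨⋃ k, S k, fun I => ?_⟩
  simp only [Set.mem_iUnion, forall_exists_index, ← hS]
  exact forall_comm

theorem Expressible.congr {P Q : Interp NC NR NIS → Prop} (hP : Expressible P)
    (h : ∀ I, P I ↔ Q I) : Expressible Q :=
  (funext fun I => propext (h I) : P = Q) ▸ hP

theorem expressible_mem (C : Concept NC NR NI) (a : NI) :
    Expressible fun I : Interp NC NR NIS => I.ind a ∈ C.interp I :=
  .of_assertion (.concept C a) fun _ => .rfl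

theorem expressible_notMem (C : Concept NC NR NI) (a : NI) :
    Expressible fun I : Interp NC NR NIS => I.ind a ∉ C.interp I :=
  .of_assertion (.concept (.neg C) a) fun _ => .rfl

theorem expressible_role (R : Role NR) (a b : NI) :
    Expressible fun I : Interp NC NR NIS => R.interp I (I.ind a) (I.ind b) :=
  .of_assertion (.role R a b) fun _ => .rfl

theorem expressible_not_role (R : Role NR) (a b : NI) :
    Expressible fun I : Interp NC NR NIS => ¬ R.interp I (I.ind a) (I.ind b) :=
  .of_assertion (.negRole R a b) fun _ => .rfl

/-- A set of assertions is a conjunction, so the disjunction in a failed equivalence has to move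
inside one concept, the symmetric difference of `C` and `D`. -/
theorem expressible_not_mem_iff_mem (C D : Concept NC NR NI) (a : NI) :
    Expressible fun I : Interp NC NR NIS => ¬ (I.ind a ∈ C.interp I ↔ I.ind a ∈ D.interp I) :=
  .of_assertion (.concept (.sup (.inf C (.neg D)) (.inf (.neg C) D)) a) fun I => by
    simp only [Assertion.Sat, Concept.interp, Set.mem_union, Set.mem_inter_iff,
      Set.mem_compl_iff]
    tauto

theorem Assertion.expressible_not_sat (s : Assertion NC NR NI) :
    Expressible fun I : Interp NC NR NIS => ¬ s.Sat I := by
  cases s with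
  | concept C a => exact expressible_notMem C a
  | role R a b => exact expressible_not_role R a b
  | negRole R a b => exact (expressible_role R a b).congr fun I => not_not.symm
  | eq a b => exact .of_assertion (.ne a b) fun _ => .rfl
  | ne a b => exact .of_assertion (.eq a b) fun _ => not_not.symm

/-- Once the leading universal quantifiers are instantiated by names, the negated matrix is a
conjunction of assertions about these names. -/
theorem Concept.expressible_not_inst (D : Concept NC NR NI) (a : NI) (e : List NI) :
    Expressible fun I : Interp NC NR NIS => ¬ D.Inst I a e := by
  induction D generalizing a e with
  | all R C ih =>
    cases e with
    | nil => exact expressible_notMem _ a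
    | cons b e =>
      exact ((expressible_role R a b).and (ih b e)).congr fun I => by
        simp only [Concept.Inst, Classical.not_imp]
  | atMost n R C =>
    have hall : Expressible fun I : Interp NC NR NIS =>
        ∀ b, ∀ _ : b ∈ e, R.interp I (I.ind a) (I.ind b) ∧ I.ind b ∈ C.interp I :=
      .forall fun b => .forall fun _ => (expressible_role R a b).and (expressible_mem C b)
    by_cases he : e.Nodup
    · refine hall.congr fun I => ?_
      simp only [Concept.Inst, List.nodup_map_iff I.ind_injective, he, not_true_eq_false,
        imp_false, not_not]
    -- A tuple with a repeated name satisfies the instance in every interpretation, so its failure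
    -- is expressed by an inconsistent assertion.
    · refine (Expressible.of_assertion (.ne a a) fun I => ?_)
      simp only [Concept.Inst, List.nodup_map_iff I.ind_injective, he, Assertion.Sat]
      simp
  | _ => exact expressible_notMem _ a

theorem expressible_not_chainInst (S : Role NR) (x y : NI) (w : List (Role NR)) (e : List NI) :
    Expressible fun I : Interp NC NR NIS => ¬ chainInst I S x w y e := by
  induction w generalizing y e with
  | nil => exact expressible_not_role S x y
  | cons R w ih =>
    cases e with
    | nil => exact expressible_not_role S x y
    | cons z e =>
      exact ((expressible_role R y z).and (ih z e)).congr fun I => by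
        simp only [chainInst, Classical.not_imp]

/-- The negation of an instance of an axiom is expressible by ABox assertions. -/
theorem Ax.expressible_not_inst (α : Ax NC NR NI) (e : List NI) :
    Expressible fun I : Interp NC NR NIS => ¬ α.Inst I e := by
  -- An instance that never holds, such as one with a tuple of the wrong shape, fails vacuously and
  -- needs no assertion. Below, `hF` thus discards the default clause of `Ax.Inst`.
  by_cases hF : ∀ I : Interp NC NR NIS, ¬ α.Inst I e
  · exact expressible_true.congr fun I => by simp [hF I]
  cases α with
  | conceptIncl C D =>
    rcases e with _ | ⟨a, e⟩
    · exact (hF fun _ h => h).elim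
    exact ((expressible_mem C a).and (D.expressible_not_inst a e)).congr fun I => by
      simp only [Ax.Inst, Classical.not_imp]
  | conceptEquiv C D =>
    rcases e with _ | ⟨a, _ | ⟨b, e⟩⟩ <;> try exact (hF fun _ h => h).elim
    exact expressible_not_mem_iff_mem C D a
  | roleIncl R w S =>
    rcases e with _ | ⟨a, e⟩
    · exact (hF fun _ h => h).elim
    exact expressible_not_chainInst S a a (R :: w) e
  | disjoint R S =>
    rcases e with _ | ⟨a, _ | ⟨b, _ | ⟨c, e⟩⟩⟩ <;> try exact (hF fun _ h => h).elim
    exact ((expressible_role R a b).and (expressible_role S a b)).congr fun I => by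
      simp only [Ax.Inst, not_not]
  | inverse R S =>
    rcases e with _ | ⟨a, _ | ⟨b, _ | ⟨c, e⟩⟩⟩ <;> try exact (hF fun _ h => h).elim
    refine (expressible_not_mem_iff_mem (.ex R (.nominal b)) (.ex (.inv S) (.nominal b)) a).congr
      fun I => ?_
    simp only [Ax.Inst, Role.mem_ex_nominal, Role.interp]
  | refl R =>
    rcases e with _ | ⟨a, _ | ⟨b, e⟩⟩ <;> try exact (hF fun _ h => h).elim
    exact expressible_not_role R a a
  | irrefl R =>
    rcases e with _ | ⟨a, _ | ⟨b, e⟩⟩ <;> try exact (hF fun _ h => h).elim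
    exact (expressible_role R a a).congr fun I => by simp only [Ax.Inst, not_not]
  | symm R =>
    rcases e with _ | ⟨a, _ | ⟨b, _ | ⟨c, e⟩⟩⟩ <;> try exact (hF fun _ h => h).elim
    exact ((expressible_role R a b).and (expressible_not_role R b a)).congr fun I => by
      simp only [Ax.Inst, Classical.not_imp]
  | asymm R =>
    rcases e with _ | ⟨a, _ | ⟨b, _ | ⟨c, e⟩⟩⟩ <;> try exact (hF fun _ h => h).elim
    exact ((expressible_role R a b).and (expressible_role R b a)).congr fun I => by
      simp only [Ax.Inst, Classical.not_imp, not_not]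
  | trans R =>
    rcases e with _ | ⟨a, _ | ⟨b, _ | ⟨c, _ | ⟨d, e⟩⟩⟩⟩ <;>
      try exact (hF fun _ h => h).elim
    exact ((expressible_role R a b).and
      ((expressible_role R b c).and (expressible_not_role R a c))).congr fun I => by
        simp only [Ax.Inst, Classical.not_imp]
  | assertion s =>
    rcases e with _ | ⟨a, e⟩
    · exact s.expressible_not_sat
    exact (hF fun _ h => h).elim

end NegInst

/-! ### Coincidence for instances of axioms. -/

section InstCoincidence

variable {NC NR NI : Type*} {NIS : Set NI}

theorem Role.mem_subs (NC NI : Type*) (R : Role NR) : Expr.role R ∈ R.subs NC NI := by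
  cases R <;> simp [Role.subs]

theorem Concept.mem_subs (C : Concept NC NR NI) : Expr.concept C ∈ C.subs := by
  cases C <;> simp [Concept.subs]

theorem Concept.inst_congr {I I' : Interp NC NR NIS} (D : Concept NC NR NI)
    (h : AgreeOn I I' D.subs) (a : NI) (e : List NI) : D.Inst I a e ↔ D.Inst I' a e := by
  induction D generalizing a e with
  | all R C ih =>
    cases e with
    | nil => simp only [Concept.Inst, Concept.interp_congr _ h, I.ind_unique I']
    | cons b e =>
      obtain ⟨hR, hC⟩ := agreeOn_union.1 (h.mono (Set.subset_insert _ _))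
      simp only [Concept.Inst, R.interp_congr hR, ih hC, I.ind_unique I']
  | atMost n R C =>
    obtain ⟨hR, hC⟩ := agreeOn_union.1 (h.mono (Set.subset_insert _ _))
    simp only [Concept.Inst, R.interp_congr hR, C.interp_congr hC, I.ind_unique I']
  | _ => simp only [Concept.Inst, Concept.interp_congr _ h, I.ind_unique I']

theorem chainInst_congr {I I' : Interp NC NR NIS} (S : Role NR) (x y : NI) (w : List (Role NR))
    (e : List NI) (hw : AgreeOn I I' {X | ∃ Q ∈ w, X ∈ Q.subs NC NI})
    (hS : AgreeOn I I' (S.subs NC NI)) : chainInst I S x w y e ↔ chainInst I' S x w y e := by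
  induction w generalizing y e with
  | nil => simp only [chainInst, S.interp_congr hS, I.ind_unique I']
  | cons R w ih =>
    cases e with
    | nil => simp only [chainInst, S.interp_congr hS, I.ind_unique I']
    | cons z e =>
      have hR : R.interp I = R.interp I' :=
        R.interp_congr (hw.mono fun X hX => ⟨R, List.mem_cons_self, hX⟩)
      have hw' := ih z e (hw.mono fun X ⟨Q, hQ, hX⟩ => ⟨Q, List.mem_cons_of_mem _ hQ, hX⟩)
      simp only [chainInst, hR, hw', I.ind_unique I']

theorem Ax.inst_congr {I I' : Interp NC NR NIS} (α : Ax NC NR NI) (h : AgreeOn I I' α.exprs)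
    (e : List NI) : α.Inst I e ↔ α.Inst I' e := by
  cases α with
  | conceptIncl C D =>
    obtain ⟨hC, hD⟩ := agreeOn_union.1 h
    cases e with
    | nil => exact .rfl
    | cons a e => simp only [Ax.Inst, C.interp_congr hC, D.inst_congr hD, I.ind_unique I']
  | conceptEquiv C D =>
    obtain ⟨hC, hD⟩ := agreeOn_union.1 h
    rcases e with _ | ⟨a, _ | ⟨b, e⟩⟩ <;>
      simp only [Ax.Inst, C.interp_congr hC, D.interp_congr hD, I.ind_unique I']
  | roleIncl R w S =>
    obtain ⟨hRw, hS⟩ := agreeOn_union.1 h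
    cases e with
    | nil => exact .rfl
    | cons a e =>
      refine chainInst_congr S a a (R :: w) e (hRw.mono ?_) hS
      rintro X ⟨Q, hQ, hX⟩
      rcases List.mem_cons.1 hQ with rfl | hQ
      · exact .inl hX
      · exact .inr ⟨Q, hQ, hX⟩
  | disjoint R S | inverse R S =>
    obtain ⟨hR, hS⟩ := agreeOn_union.1 h
    rcases e with _ | ⟨a, _ | ⟨b, _ | ⟨c, e⟩⟩⟩ <;>
      simp only [Ax.Inst, R.interp_congr hR, S.interp_congr hS, I.ind_unique I']
  | refl R | irrefl R | symm R | asymm R | trans R =>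
    rcases e with _ | ⟨a, _ | ⟨b, _ | ⟨c, _ | ⟨d, e⟩⟩⟩⟩ <;>
      simp only [Ax.Inst, R.interp_congr h, I.ind_unique I']
  | assertion s =>
    cases e with
    | nil => exact s.sat_congr h
    | cons a e => exact .rfl

end InstCoincidence

/-! ### Atoms of renamed expressions -/

section Renaming

variable {NC NR NC₂ NR₂ NI : Type*} (f : NC → NC₂) (g : NR → NR₂)

/-- The renaming of the atomic concepts and roles of an expression. -/
def Expr.map : Expr NC NR NI → Expr NC₂ NR₂ NI
  | .concept C => .concept (C.map f g)
  | .role R => .role (R.map g)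

/-- This and the next two lemmas carry occurrences in the description logic over to the contextual
language, whose expressions label the dependency graph. -/
theorem Role.map_mem_subs {X : Expr NC NR NI} {R : Role NR} (h : X ∈ R.subs NC NI) :
    X.map f g ∈ (R.map g).subs NC₂ NI := by
  induction R with
  | atom R | univ => cases h; rfl
  | inv R ih => exact h.elim (fun h => .inl (h ▸ rfl)) fun h => .inr (ih h)

theorem Concept.map_mem_subs {X : Expr NC NR NI} {C : Concept NC NR NI} (h : X ∈ C.subs) :
    X.map f g ∈ (C.map f g).subs := by
  induction C with
  | atom | top | bot | nominal => cases h; rfl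
  | neg C ih => exact h.elim (fun h => .inl (h ▸ rfl)) fun h => .inr (ih h)
  | inf C D ihC ihD | sup C D ihC ihD =>
    exact h.elim (fun h => .inl (h ▸ rfl)) fun h => .inr (h.imp ihC ihD)
  | ex R C ih | all R C ih | atLeast n R C ih | atMost n R C ih =>
    exact h.elim (fun h => .inl (h ▸ rfl)) fun h => .inr (h.imp (R.map_mem_subs f g) ih)
  | self R => exact h.elim (fun h => .inl (h ▸ rfl)) fun h => .inr (R.map_mem_subs f g h)

theorem Ax.map_mem_exprs {X : Expr NC NR NI} {α : Ax NC NR NI} (h : X ∈ α.exprs) :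
    X.map f g ∈ (α.map f g).exprs := by
  cases α with
  | conceptIncl C D | conceptEquiv C D =>
    exact h.imp (C.map_mem_subs f g) (D.map_mem_subs f g)
  | roleIncl R w S =>
    refine h.imp (Or.imp (R.map_mem_subs f g) ?_) (S.map_mem_subs f g)
    rintro ⟨Q, hQ, hX⟩
    exact ⟨Q.map g, List.mem_map_of_mem hQ, Q.map_mem_subs f g hX⟩
  | disjoint R S | inverse R S => exact h.imp (R.map_mem_subs f g) (S.map_mem_subs f g)
  | refl R | irrefl R | symm R | asymm R | trans R => exact R.map_mem_subs f g h
  | assertion s =>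
    cases s with
    | concept C a => exact C.map_mem_subs f g h
    | role R a b | negRole R a b => exact R.map_mem_subs f g h
    | eq a b | ne a b => exact h.elim

end Renaming

/-! ### Unions of components of the dependency graph -/

section Components

variable {NC NR NI N : Type*} {m : ℕ} {NIS : Set NI} {K : SCKR NC NR NI N m}

/-- `W` is a union of connected components of the dependency graph. -/
def SCKR.IsSaturated (K : SCKR NC NR NI N m) (W : Set (CExpr NC NR NI N × N)) : Prop :=
  ∀ p q, K.DepEdge p q → (p ∈ W ↔ q ∈ W)

theorem SCKR.IsSaturated.compl {W : Set (CExpr NC NR NI N × N)} (hW : K.IsSaturated W) :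
    K.IsSaturated Wᶜ :=
  fun p q h => not_congr (hW p q h)

/-- The vertices that are connected to `X_c` for some `X` that occurs in a default axiom. -/
def SCKR.defaultPart (K : SCKR NC NR NI N m) (c : N) : Set (CExpr NC NR NI N × N) :=
  {p | ∃ X, K.OccursInDefault X ∧ Relation.EqvGen K.DepEdge (X, c) p}

theorem SCKR.isSaturated_defaultPart (K : SCKR NC NR NI N m) (c : N) :
    K.IsSaturated (K.defaultPart c) := by
  intro p q h
  constructor
  · rintro ⟨X, hX, hp⟩
    exact ⟨X, hX, hp.trans _ _ _ (.rel _ _ h)⟩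
  · rintro ⟨X, hX, hq⟩
    exact ⟨X, hX, hq.trans _ _ _ (.symm _ _ (.rel _ _ h))⟩

theorem SCKR.OccursInDefault.mem_defaultPart {X : CExpr NC NR NI N} (h : K.OccursInDefault X)
    (c : N) : (X, c) ∈ K.defaultPart c :=
  ⟨X, h, .refl _⟩

/-- The only point where the definition of eval-disconnectedness is unfolded. -/
theorem SCKR.EvalDisconnected.notMem_defaultPart (hK : K.EvalDisconnected)
    {X : CExpr NC NR NI N} (h : K.OccursInDefault X) {c d : N} (hcd : d ≠ c) :
    (X, d) ∉ K.defaultPart c := by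
  rintro ⟨Y, hY, hp⟩
  exact hK Y X hY h c d hcd.symm hp

/-- `I` and `I'` coincide on the atoms of the DL at the vertices in `W`. -/
def CInterp.AgreeOn (I I' : CInterp NC NR NIS N) (W : Set (CExpr NC NR NI N × N)) : Prop :=
  (∀ A d, (.concept (.atom (.base A)), d) ∈ W → (I.loc d).con A = (I'.loc d).con A) ∧
    ∀ R d, (.role (.atom (.base R)), d) ∈ W → (I.loc d).rol R = (I'.loc d).rol R

theorem CInterp.AgreeOn.loc {I I' : CInterp NC NR NIS N} {W : Set (CExpr NC NR NI N × N)}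
    (h : I.AgreeOn I' W) {E : Set (Expr NC NR NI)} {d : N}
    (hE : ∀ X ∈ E, (X.map .base .base, d) ∈ W) : CKR.AgreeOn (I.loc d) (I'.loc d) E :=
  ⟨fun A hA => h.1 A d (hE _ hA), fun R hR => h.2 R d (hE _ hR)⟩

/-- The value of an atom `eval(X, c)` is determined at `c`, not at `d`. The `eval` edge leads to `X`
at `c` and the subexpression edges to its atoms, so saturation keeps all of them in `W`. Occurrence
in `K` is required because only occurring expressions have these edges. -/
theorem CInterp.AgreeOn.ext {I I' : CInterp NC NR NIS N} {W : Set (CExpr NC NR NI N × N)}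
    (hW : K.IsSaturated W) (h : I.AgreeOn I' W) {E : Set (CExpr NC NR NI N)} {d : N}
    (hE : ∀ X ∈ E, K.Occurs X ∧ (X, d) ∈ W) : CKR.AgreeOn (I.ext d) (I'.ext d) E := by
  constructor
  · rintro (A | ⟨C, c⟩) hA
    · exact h.1 A d (hE _ hA).2
    · obtain ⟨hocc, hmem⟩ := hE _ hA
      refine C.interp_congr (h.loc fun X hX => ?_)
      have hC := (hW _ _ (.evalConcept d c hocc)).1 hmem
      exact (hW _ _ (.sub c (hocc.ofEvalConcept (C.lift N).mem_subs)
        (C.map_mem_subs _ _ hX))).1 hC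
  · rintro (R | ⟨R, c⟩) hR
    · exact h.2 R d (hE _ hR).2
    · obtain ⟨hocc, hmem⟩ := hE _ hR
      refine R.interp_congr (NC := NC) (h.loc fun X hX => ?_)
      have hC := (hW _ _ (.evalRole d c hocc)).1 hmem
      exact (hW _ _ (.sub c (hocc.ofEvalRole ((R.lift N).mem_subs _ _))
        (R.map_mem_subs _ _ hX))).1 hC

end Components

/-! ### Merging CAS-interpretations -/

section Merge

variable {NC NR NI N : Type*} {m : ℕ} {NIS : Set NI} {K : SCKR NC NR NI N m}

open scoped Classical in
/-- The interpretation that is `I₁` on the vertices in `W` and `I₂` elsewhere. -/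
def CInterp.merge (W : Set (CExpr NC NR NI N × N)) (I₁ I₂ : CInterp NC NR NIS N) :
    CInterp NC NR NIS N where
  loc d :=
    { ind := (I₂.loc d).ind
      ind_standard := (I₂.loc d).ind_standard
      ind_injective := (I₂.loc d).ind_injective
      con := fun A => if (.concept (.atom (.base A)), d) ∈ W then (I₁.loc d).con A
        else (I₂.loc d).con A
      rol := fun R => if (.role (.atom (.base R)), d) ∈ W then (I₁.loc d).rol R
        else (I₂.loc d).rol R }
  ind_eq := I₂.ind_eq

theorem CInterp.merge_agreeOn (W : Set (CExpr NC NR NI N × N)) (I₁ I₂ : CInterp NC NR NIS N) :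
    (merge W I₁ I₂).AgreeOn I₁ W :=
  ⟨fun _ _ h => if_pos h, fun _ _ h => if_pos h⟩

theorem CInterp.merge_agreeOn_compl (W : Set (CExpr NC NR NI N × N))
    (I₁ I₂ : CInterp NC NR NIS N) : (merge W I₁ I₂).AgreeOn I₂ Wᶜ :=
  ⟨fun _ _ h => if_neg h, fun _ _ h => if_neg h⟩

open scoped Classical in
/-- The CAS-interpretation that is `J₁` on the part of the dependency graph connected to default
axioms at `c`, with the clashing assumptions of `J₁` for `c`, and `J₂` elsewhere. -/
noncomputable def CASInterp.merge (c : N) (J₁ J₂ : CASInterp K NIS) : CASInterp K NIS where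
  interp := .merge (K.defaultPart c) J₁.interp J₂.interp
  chi i d := if d = c then J₁.chi i d else J₂.chi i d
  chi_clashing i d x hx := by
    split_ifs at hx
    exacts [J₁.chi_clashing i d x hx, J₂.chi_clashing i d x hx]

theorem CASInterp.merge_chi_self (c : N) (J₁ J₂ : CASInterp K NIS) (i : Fin m) :
    (merge c J₁ J₂).chi i c = J₁.chi i c :=
  if_pos rfl

theorem CASInterp.merge_chi_of_ne {c d : N} (h : d ≠ c) (J₁ J₂ : CASInterp K NIS) (i : Fin m) :
    (merge c J₁ J₂).chi i d = J₂.chi i d :=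
  if_neg h

/-- At the context `c` the merged interpretation coincides with `J₁` on default axioms. -/
theorem CASInterp.merge_agreeOn_self (c : N) (J₁ J₂ : CASInterp K NIS) {d : N} {i : Fin m}
    {α : Ax NC NR NI} (hα : (i, α) ∈ K.defeasible d) :
    AgreeOn ((merge c J₁ J₂).interp.loc c) (J₁.interp.loc c) α.exprs :=
  (CInterp.merge_agreeOn _ _ _).loc fun _ hX =>
    SCKR.OccursInDefault.mem_defaultPart ⟨d, i, α, hα, α.map_mem_exprs _ _ hX⟩ c

/-- At other contexts the merged interpretation coincides with `J₂` on default axioms. -/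
theorem CASInterp.merge_agreeOn_of_ne (hK : K.EvalDisconnected) {c c' : N} (hc : c' ≠ c)
    (J₁ J₂ : CASInterp K NIS) {d : N} {i : Fin m} {α : Ax NC NR NI}
    (hα : (i, α) ∈ K.defeasible d) :
    AgreeOn ((merge c J₁ J₂).interp.loc c') (J₂.interp.loc c') α.exprs :=
  (CInterp.merge_agreeOn_compl _ _ _).loc fun _ hX =>
    hK.notMem_defaultPart ⟨d, i, α, hα, α.map_mem_exprs _ _ hX⟩ hc

/-- Every axiom, evaluated at a context, lies entirely inside or entirely outside the default part
at `c`, and so inherits its truth from one of the two models. For defaults the context of evaluation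
decides the side, and it selects the clashing assumptions of that same side. -/
theorem CASInterp.IsModel.merge (hK : K.EvalDisconnected) (c : N) {J₁ J₂ : CASInterp K NIS}
    (h₁ : J₁.IsModel) (h₂ : J₂.IsModel) : (CASInterp.merge c J₁ J₂).IsModel where
  strict d α hα d' hd := by
    have hax : α ∈ K.axioms := ⟨d, .inl hα⟩
    have hW := K.isSaturated_defaultPart c
    -- By the co-occurrence edges, one expression of `α` in the default part draws in all the
    -- others.
    by_cases hex : ∃ X ∈ α.exprs, (X, d') ∈ K.defaultPart c
    · obtain ⟨X, hX, hXW⟩ := hex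
      refine (α.sat_congr ((CInterp.merge_agreeOn _ _ _).ext hW fun Y hY =>
        ⟨.ofAx hax hY, ?_⟩)).2 (h₁.strict d α hα d' hd)
      exact (hW _ _ (.cooccur d' hax hX hY)).1 hXW
    · exact (α.sat_congr ((CInterp.merge_agreeOn_compl _ _ _).ext hW.compl fun Y hY =>
        ⟨.ofAx hax hY, fun h => hex ⟨Y, hY, h⟩⟩)).2 (h₂.strict d α hα d' hd)
  parallel d j α hα d' hd := by
    by_cases hc : d' = c
    · subst hc
      exact (α.sat_congr (merge_agreeOn_self d' J₁ J₂ hα)).2 (h₁.parallel d j α hα d' hd)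
    · exact (α.sat_congr (merge_agreeOn_of_ne hK hc J₁ J₂ hα)).2 (h₂.parallel d j α hα d' hd)
  defeasible d j α hα d' d'' hprec hle e he hne := by
    by_cases hc : d'' = c
    · subst hc
      rw [merge_chi_self] at hne
      exact (α.inst_congr (merge_agreeOn_self d'' J₁ J₂ hα) e).2
        (h₁.defeasible d j α hα d' d'' hprec hle e he hne)
    · rw [merge_chi_of_ne hc] at hne
      exact (α.inst_congr (merge_agreeOn_of_ne hK hc J₁ J₂ hα) e).2
        (h₂.defeasible d j α hα d' d'' hprec hle e he hne)

theorem CASInterp.congruent (J J' : CASInterp K NIS) : J.Congruent J' :=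
  fun _ => Interp.ind_unique _ _

/-- A CAS-model is justified iff every clashing assumption fails in all the CAS-models with the
same clashing assumptions. -/
theorem CASInterp.isJustified_iff {J : CASInterp K NIS} :
    J.IsJustified ↔ J.IsModel ∧ ∀ i c, ∀ x ∈ J.chi i c, ∀ J' : CASInterp K NIS, J'.IsModel →
      J'.chi = J.chi → ¬ x.1.Inst (J'.interp.loc c) x.2 := by
  refine and_congr_right fun hJ => forall₄_congr fun i c x hx => ?_
  constructor
  · rintro ⟨S, hS, hsat⟩ J' hJ' hchi hinst
    exact hS.2 ⟨_, hsat J' hJ' hchi (J'.congruent J), hinst⟩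
  · intro h
    -- The clashing set is the failure of the instance itself; `J` witnesses that it is satisfiable.
    obtain ⟨S, hS⟩ := x.1.expressible_not_inst (NIS := NIS) x.2
    exact ⟨S, ⟨⟨_, (hS (J.interp.loc c)).2 (h J hJ rfl)⟩, fun ⟨I, hI, hinst⟩ => (hS I).1 hI hinst⟩,
      fun J' hJ' hchi _ => (hS _).2 (h J' hJ' hchi)⟩

/-- If the clashing assumptions of `J'` and of a justified `J` for the context `c` are the same,
then those of `J` for `c` fail at `c` in every CAS-model with the clashing assumptions of `J'`. -/
theorem CASInterp.IsJustified.not_inst_of_chi_eq (hK : K.EvalDisconnected) {J J' : CASInterp K NIS}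
    (hJ : J.IsJustified) (hJ' : J'.IsModel) {c : N} (hchi : ∀ i, J'.chi i c = J.chi i c)
    {i : Fin m} {x : Ax NC NR NI × List NI} (hx : x ∈ J.chi i c) :
    ¬ x.1.Inst (J'.interp.loc c) x.2 := by
  obtain ⟨hmod, hfail⟩ := isJustified_iff.1 hJ
  obtain ⟨-, b, d, hd, -⟩ := J.chi_clashing i c x hx
  -- Transplanting `J'` at `c` into `J` gives a model with exactly the assumptions of `J`, to which
  -- the justification of `J` applies. At `c` this model agrees with `J'` on defaults, so the
  -- failure passes to `J'`. Agreement of the assumptions for `c` is needed for all relations, since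
  -- `merge` replaces all of them.
  have heq : (merge c J' J).chi = J.chi := by
    funext j d
    by_cases hdc : d = c
    · subst hdc
      rw [merge_chi_self, hchi]
    · exact merge_chi_of_ne hdc J' J j
  have := hfail i c x hx (merge c J' J) (hJ'.merge hK c hmod) heq
  rwa [x.1.inst_congr (merge_agreeOn_self c J' J hd)] at this

/-- Justification can be checked one context at a time: a model with the merged assumptions shares
those of `J₁` at `c` and those of `J₂` at every other context. -/
theorem CASInterp.IsJustified.merge (hK : K.EvalDisconnected) (c : N) {J₁ J₂ : CASInterp K NIS}
    (h₁ : J₁.IsJustified) (h₂ : J₂.IsJustified) : (CASInterp.merge c J₁ J₂).IsJustified := by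
  refine isJustified_iff.2 ⟨h₁.1.merge hK c h₂.1, fun i d x hx J' hJ' hchi => ?_⟩
  by_cases hd : d = c
  · subst hd
    rw [merge_chi_self] at hx
    exact h₁.not_inst_of_chi_eq hK hJ' (fun j => by rw [hchi, merge_chi_self]) hx
  · rw [merge_chi_of_ne hd] at hx
    exact h₂.not_inst_of_chi_eq hK hJ' (fun j => by rw [hchi, merge_chi_of_ne hd]) hx

end Merge

/-! ### Comparison of the preference relations -/

section Preference

variable {NC NR NI N : Type*} {m : ℕ} {NIS : Set NI} {K : SCKR NC NR NI N m}

theorem SCKR.locPref_refl (K : SCKR NC NR NI N m) (i : Fin m) (c : N)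
    (X : Set (Ax NC NR NI × List NI)) : K.LocPref i c X X :=
  fun _ hx => (hx.2 hx.1).elim

/-- Reflexivity covers contexts with equal assumptions, so no context can be strictly worse. -/
theorem P₂.p₁ {i : Fin m} {J₁ J₂ : CASInterp K NIS} (h : P₂ i J₁ J₂) : P₁ i J₁ J₂ := by
  obtain ⟨⟨c, hc⟩, hall⟩ := h
  refine ⟨c, hc, fun ⟨c', _, _, hnot⟩ => hnot ?_⟩
  rcases hall c' with h | h
  · exact h
  · exact h ▸ K.locPref_refl i c' _

/-- Only the strict improvement at one context matters: merging resets all other contexts to `J₂`,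
which makes the global clause of `P₂` an equality there. -/
theorem P₁.exists_p₂_merge {i : Fin m} {J₁ J₂ : CASInterp K NIS} (h : P₁ i J₁ J₂) :
    ∃ c, P₂ i (CASInterp.merge c J₁ J₂) J₂ := by
  obtain ⟨c, hc, -⟩ := h
  refine ⟨c, ⟨c, by rwa [CASInterp.merge_chi_self]⟩, fun c' => ?_⟩
  by_cases hcc : c' = c
  · subst hcc
    rw [CASInterp.merge_chi_self]
    exact .inl hc.1
  · exact .inr (CASInterp.merge_chi_of_ne hcc J₁ J₂ i)

end Preference

end CKR

theorem theorem5 {NC NR NI N : Type*} {m : ℕ} (NIS : Set NI) (K : CKR.SCKR NC NR NI N m)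
    (hK : K.EvalDisconnected) (J : CKR.CASInterp K NIS) (hJ : J.IsJustified) (i : Fin m) :
    CKR.IsPreferred (CKR.P₁ i) J ↔ CKR.IsPreferred (CKR.P₂ i) J := by
  refine not_congr ⟨?_, ?_⟩
  · rintro ⟨J', hJ', h⟩
    obtain ⟨c, hc⟩ := h.exists_p₂_merge
    exact ⟨_, hJ'.merge hK c hJ, hc⟩
  · rintro ⟨J', hJ', h⟩
    exact ⟨J', hJ', h.p₁⟩
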